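/- Let $\mathcal H$ be a complex Hilbert space. A \emph{metric operator} is a strictly positive self-adjoint operator $G$ in $\mathcal H$, bounded or not: $\langle G\xi,\xi\rangle\ge 0$ for all $\xi\in D(G)$, with equality only for $\xi=0$. Let $\mathcal H(G)$ be the completion of $D(G^{1/2})$ for the norm $\|\xi\|_G=\|G^{1/2}\xi\|$; then $G^{1/2}$ extends to a unitary operator $\mathcal H(G)\to\mathcal H$, again denoted $G^{1/2}$, with inverse $G^{-1/2}$. Let $\mathcal O$ be a family of metric operators with $I\in\mathcal O$, let $V^{\#}=\bigcap_{G\in\mathcal O}\big(D(G^{1/2})\cap D(G^{-1/2})\big)$, and let $\Sigma$ be the smallest set of operators that contains $\mathcal O$ and is stable under inversion and form sums. Assume that $V^{\#}$ is contained and dense in $\mathcal H(Z)$ for every $Z\in\Sigma$. Then all the spaces $\mathcal H(Z)$, $Z\in\Sigma$, are realized inside the conjugate dual of $V^{\#}$; they generate a pip-space $V_{\mathcal I}$ with total space $V=\sum_{Z\in\Sigma}\mathcal H(Z)$ and partial inner product $\langle f|g\rangle=\langle Z^{1/2}f,Z^{-1/2}g\rangle$ for $f\in\mathcal H(Z)$,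 $g\in\mathcal H(Z^{-1})$. An operator $A\in\mathrm{Op}(V_{\mathcal I})$ is a linear map $A:D(A)\to V$ whose domain is the union of a nonempty family of spaces $\mathcal H(Y)$, $Y\in\Sigma$, each of which $A$ maps continuously into some $\mathcal H(X)$, $X\in\Sigma$, and which has no proper extension of this kind. Let $\mathsf j(A)$ be the set of pairs $(X,Y)\in\Sigma\times\Sigma$ such that $A$ maps $\mathcal H(Y)$ continuously into $\mathcal H(X)$, with representative $A_{XY}=A\restriction\mathcal H(Y)$. The adjoint $A^\times$ is the operator that, for all $(X,Y)\in\mathsf j(A)$, maps $\mathcal H(X^{-1})$ continuously into $\mathcal H(Y^{-1})$ and satisfies $\langle A^\times x|y\rangle=\langle x|Ay\rangle$ for $x\in\mathcal H(X^{-1})$, $y\in\mathcal H(Y)$. The restriction $\mathsf A$ of $A$ to $\mathcal H$ has domain $D(\mathsf A)=\{\xi\in\mathcal H\cap D(A): A\xi\in\mathcal H\}$ and $\mathsf A\xi=A\xi$. Densely defined operators $C$ in $\mathcal H$ and $B$ in $\mathcal K$ are \emph{quasi-similar}, $C\dashv B$, if there is a bounded operator $T:\mathcal H\to\mathcal K$,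 invertible with densely defined (possibly unbounded) inverse, such that $T D(C)\subseteq D(B)$ and $BT\xi=TC\xi$ for all $\xi\in D(C)$; $T$ is then called an intertwining operator. \textbf{Proposition.} Let $A=A^\times\in\mathrm{Op}(V_{\mathcal I})$ be symmetric and let $G$ be a metric operator, bounded or not, with $(G,G)\in\mathsf j(A)$. Then $D(\mathsf A)$ is dense in $\mathcal H$, and $\mathsf A$ is quasi-similar to a bounded, everywhere defined operator on $\mathcal H$. Moreover $\mathsf B:=G^{1/2}A_{GG}G^{-1/2}$ is a bounded, everywhere defined operator on $\mathcal H$; and if $G$ is bounded, then $\mathsf A$ is closed and $\mathsf A\dashv\mathsf B$ with intertwining operator $G^{1/2}$. -/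

import Mathlib

namespace PipSpace

open scoped InnerProductSpace Topology
open Filter

variable {H : Type*} [NormedAddCommGroup H] [InnerProductSpace ℂ H] [CompleteSpace H]

/-! ### Metric operators and their square roots

Unbounded operators in `H` are partially defined linear maps `H →ₗ.[ℂ] H`; Mathlib's
`IsSelfAdjoint` is equality with the Hilbert space adjoint and forces a dense domain. -/

/-- A metric operator: a strictly positive self-adjoint operator, bounded or not. -/
structure IsMetricOperator (G : H →ₗ.[ℂ] H) : Prop where
  selfAdjoint : IsSelfAdjoint G
  nonneg : ∀ x : G.domain, 0 ≤ (⟪G x, (x : H)⟫_ℂ).re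
  strict : ∀ x : G.domain, ⟪G x, (x : H)⟫_ℂ = 0 → (x : H) = 0

/-- A metric operator that is bounded. -/
def IsBoundedMetricOperator (G : H →ₗ.[ℂ] H) : Prop :=
  IsMetricOperator G ∧ ∃ M : ℝ, ∀ x : G.domain, ‖G x‖ ≤ M * ‖(x : H)‖

/-- `S` is a positive self-adjoint square root of `G`, that is `S ∘ S = G` including domains. -/
structure IsPositiveSqrt (G S : H →ₗ.[ℂ] H) : Prop where
  selfAdjoint : IsSelfAdjoint S
  nonneg : ∀ x : S.domain, 0 ≤ (⟪S x, (x : H)⟫_ℂ).re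
  sq : ∀ x y : H, (x, y) ∈ G.graph ↔ ∃ z : H, (x, z) ∈ S.graph ∧ (z, y) ∈ S.graph

open Classical in
/-- The positive square root `G^{1/2}` of a positive self-adjoint operator `G`
(it exists and is unique; other operators get the irrelevant value `G`). -/
noncomputable def sqrtOp (G : H →ₗ.[ℂ] H) : H →ₗ.[ℂ] H :=
  if h : ∃ S, IsPositiveSqrt G S then h.choose else G

/-- The identity operator `I`. -/
noncomputable def idOp (H : Type*) [NormedAddCommGroup H] [InnerProductSpace ℂ H] :
    H →ₗ.[ℂ] H :=
  (LinearMap.id : H →ₗ[ℂ] H).toPMap ⊤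

/-- `Z` is the form sum of `X` and `Y`: the operator associated with the sum of the quadratic
forms of `X` and `Y`, whose form domain is `D(X^{1/2}) ∩ D(Y^{1/2})`. -/
def IsFormSum (X Y Z : H →ₗ.[ℂ] H) : Prop :=
  ∀ x z : H, (x, z) ∈ Z.graph ↔
    ∃ (hX : x ∈ (sqrtOp X).domain) (hY : x ∈ (sqrtOp Y).domain),
      ∀ (w : H) (wX : w ∈ (sqrtOp X).domain) (wY : w ∈ (sqrtOp Y).domain),
        ⟪w, z⟫_ℂ = ⟪sqrtOp X ⟨w, wX⟩, sqrtOp X ⟨x, hX⟩⟫_ℂ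
          + ⟪sqrtOp Y ⟨w, wY⟩, sqrtOp Y ⟨x, hY⟩⟫_ℂ

/-! ### The pip-space generated by a family of metric operators -/

/-- The cone `Σ` generated by `O`: the smallest set of operators containing `O` and stable under
inversion and form sums. -/
inductive Cone (O : Set (H →ₗ.[ℂ] H)) : (H →ₗ.[ℂ] H) → Prop
  | of {X : H →ₗ.[ℂ] H} : X ∈ O → Cone O X
  | inv {X : H →ₗ.[ℂ] H} : Cone O X → Cone O X.inverse
  | formSum {X Y Z : H →ₗ.[ℂ] H} : Cone O X → Cone O Y → IsFormSum X Y Z → Cone O Z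

/-- The smallest space `V^#`: the intersection of the domains of all `G^{1/2}` and `G^{-1/2}`,
`G ∈ O`. -/
noncomputable def smallest (O : Set (H →ₗ.[ℂ] H)) : Submodule ℂ H :=
  ⨅ G ∈ O, (sqrtOp G).domain ⊓ (sqrtOp G).inverse.domain

/-- The standing assumptions on the generating family `O`: it consists of metric operators, it
contains `I`, and `V^#` is contained and dense in `ℋ(Z)` for every `Z ∈ Σ`. As `ℋ(Z)` is the
completion of `D(Z^{1/2})` for the norm `‖Z^{1/2} ·‖`, it is enough to express that `V^#` is dense
in `D(Z^{1/2})` for this norm. -/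
structure IsAdmissible (O : Set (H →ₗ.[ℂ] H)) : Prop where
  metric : ∀ G ∈ O, IsMetricOperator G
  id_mem : idOp H ∈ O
  smallest_le : ∀ Z, Cone O Z → smallest O ≤ (sqrtOp Z).domain
  dense : ∀ Z, Cone O Z → ∀ x : (sqrtOp Z).domain, ∀ ε > 0,
    ∃ y : (sqrtOp Z).domain, (y : H) ∈ smallest O ∧ ‖sqrtOp Z (x - y)‖ < ε

/-- The algebraic conjugate dual of `V^#`. All the spaces `ℋ(Z)`, `Z ∈ Σ`, and with them the total
space `V = ∑ ℋ(Z)` of the pip-space, are realized inside it. -/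
abbrev Ambient (O : Set (H →ₗ.[ℂ] H)) : Type _ := smallest O →ₗ⋆[ℂ] ℂ

/-- The embedding of `ℋ` into the conjugate dual of `V^#`. -/
noncomputable def embed (O : Set (H →ₗ.[ℂ] H)) : H →ₗ[ℂ] Ambient O where
  toFun x :=
    { toFun := fun y => ⟪(y : H), x⟫_ℂ
      map_add' := fun y z => by exact inner_add_left _ _ _
      map_smul' := fun c y => by exact inner_smul_left _ _ _ }
  map_add' x x' := by ext y; exact inner_add_right _ _ _
  map_smul' c x := by ext y; exact inner_smul_right _ _ _

/-- `f ∈ ℋ(G)` and `G^{1/2} f = h`, where `ℋ(G)` is the completion of `D(G^{1/2})` for the norm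
`‖G^{1/2} ·‖` and `G^{1/2}` also denotes its continuous extension `ℋ(G) → ℋ`, which is unitary:
there is a sequence `uₙ ∈ D(G^{1/2})`, Cauchy for the norm of `ℋ(G)`, with `G^{1/2} uₙ → h`, that
represents the element `f` of the conjugate dual of `V^#`. In particular `‖f‖_G = ‖h‖`. -/
def IsSqrtExt (O : Set (H →ₗ.[ℂ] H)) (G : H →ₗ.[ℂ] H) (f : Ambient O) (h : H) : Prop :=
  ∃ u : ℕ → (sqrtOp G).domain,
    Tendsto (fun n => sqrtOp G (u n)) atTop (𝓝 h) ∧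
      ∀ y : smallest O, Tendsto (fun n => embed O (u n) y) atTop (𝓝 (f y))

/-- The Hilbert space `ℋ(G)`, as a subspace of the conjugate dual of `V^#`. -/
noncomputable def hilbert (O : Set (H →ₗ.[ℂ] H)) (G : H →ₗ.[ℂ] H) : Submodule ℂ (Ambient O) where
  carrier := {f | ∃ h, IsSqrtExt O G f h}
  zero_mem' := ⟨0, fun _ => 0, by simp, fun y => by simp⟩
  add_mem' := by
    rintro f g ⟨h, u, hu, hf⟩ ⟨k, v, hv, hg⟩
    refine ⟨h + k, fun n => u n + v n, ?_, fun y => ?_⟩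
    · simpa [LinearPMap.map_add] using hu.add hv
    · simpa [map_add] using (hf y).add (hg y)
  smul_mem' := by
    rintro c f ⟨h, u, hu, hf⟩
    refine ⟨c • h, fun n => c • u n, ?_, fun y => ?_⟩
    · simpa [LinearPMap.map_smul] using hu.const_smul c
    · simpa [map_smul] using (hf y).const_mul c

/-- `A` maps `ℋ(Y)` into `ℋ(X)` continuously, i.e. `‖A f‖_X ≤ c ‖f‖_Y` for `f ∈ ℋ(Y)`. -/
def MapsContinuously (O : Set (H →ₗ.[ℂ] H)) (A : Ambient O →ₗ.[ℂ] Ambient O)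
    (X Y : H →ₗ.[ℂ] H) : Prop :=
  hilbert O Y ≤ A.domain ∧
    ∃ c : ℝ, ∀ (f : A.domain) (h : H), IsSqrtExt O Y f h →
      ∃ k : H, IsSqrtExt O X (A f) k ∧ ‖k‖ ≤ c * ‖h‖

/-- The domain of `A` is a union of a nonempty family of spaces `ℋ(Y)`, `Y ∈ Σ`, each of which `A`
maps continuously into some `ℋ(X)`, `X ∈ Σ`. -/
def IsPreOperator (O : Set (H →ₗ.[ℂ] H)) (A : Ambient O →ₗ.[ℂ] Ambient O) : Prop :=
  ∃ d : Set (H →ₗ.[ℂ] H), d.Nonempty ∧ (∀ Y ∈ d, Cone O Y) ∧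
    (A.domain : Set (Ambient O)) = ⋃ Y ∈ d, (hilbert O Y : Set (Ambient O)) ∧
    ∀ Y ∈ d, ∃ X, Cone O X ∧ MapsContinuously O A X Y

/-- `A ∈ Op(V_I)`: an operator on the pip-space, i.e. a map as above without proper extension
of the same kind. -/
def IsOperator (O : Set (H →ₗ.[ℂ] H)) (A : Ambient O →ₗ.[ℂ] Ambient O) : Prop :=
  IsPreOperator O A ∧ ∀ A', IsPreOperator O A' → A ≤ A' → A' = A

/-- The set `j(A)` of the pairs `(X, Y) ∈ Σ × Σ` such that `A` maps `ℋ(Y)` into `ℋ(X)`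
continuously. -/
def repSet (O : Set (H →ₗ.[ℂ] H)) (A : Ambient O →ₗ.[ℂ] Ambient O) :
    Set ((H →ₗ.[ℂ] H) × (H →ₗ.[ℂ] H)) :=
  {p | Cone O p.1 ∧ Cone O p.2 ∧ MapsContinuously O A p.1 p.2}

/-- `A' = A^×`: for every `(X, Y) ∈ j(A)`, the operator `A'` maps `ℋ(X⁻¹)` continuously into
`ℋ(Y⁻¹)` and `⟨A' x | y⟩ = ⟨x | A y⟩` for `x ∈ ℋ(X⁻¹)`, `y ∈ ℋ(Y)`, where the partial inner
product of `f ∈ ℋ(Z)` and `g ∈ ℋ(Z⁻¹)` is `⟨Z^{1/2} f, Z^{-1/2} g⟩`. -/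
def IsAdjointOperator (O : Set (H →ₗ.[ℂ] H)) (A A' : Ambient O →ₗ.[ℂ] Ambient O) : Prop :=
  ∀ X Y : H →ₗ.[ℂ] H, (X, Y) ∈ repSet O A → (Y.inverse, X.inverse) ∈ repSet O A' ∧
    ∀ (x : A'.domain) (y : A.domain) (x₁ y₁ x₂ y₂ : H),
      IsSqrtExt O X.inverse x x₁ → IsSqrtExt O Y y y₁ →
      IsSqrtExt O Y.inverse (A' x) x₂ → IsSqrtExt O X (A y) y₂ →
        ⟪y₁, x₂⟫_ℂ = ⟪y₂, x₁⟫_ℂ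

/-- A symmetric operator of the pip-space: `A = A^×`. -/
def IsSymmetricOperator (O : Set (H →ₗ.[ℂ] H)) (A : Ambient O →ₗ.[ℂ] Ambient O) : Prop :=
  IsOperator O A ∧ IsAdjointOperator O A A

/-- The restriction of `A` to `ℋ`: its domain consists of the `x ∈ ℋ` with `x ∈ D(A)` and
`A x ∈ ℋ`, and there it acts as `A`. -/
noncomputable def restrictToH (O : Set (H →ₗ.[ℂ] H)) (A : Ambient O →ₗ.[ℂ] Ambient O) :
    H →ₗ.[ℂ] H :=
  (A.graph.comap ((embed O).prodMap (embed O))).toLinearPMap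

/-- `B = G^{1/2} A_{GG} G^{-1/2}` on `ℋ`, with the unitary `G^{1/2} : ℋ(G) → ℋ` and its inverse:
for every `h`, `f = G^{-1/2} h` is in the domain of `A`, and `B h = G^{1/2} A f`. -/
def IsConjugate (O : Set (H →ₗ.[ℂ] H)) (A : Ambient O →ₗ.[ℂ] Ambient O) (G : H →ₗ.[ℂ] H)
    (B : H →L[ℂ] H) : Prop :=
  ∀ h : H, ∃ f : A.domain, IsSqrtExt O G f h ∧ IsSqrtExt O G (A f) (B h)

/-! ### Quasi-similarity -/

/-- A bounded, everywhere defined operator as an operator with domain. -/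
noncomputable def ofBounded (B : H →L[ℂ] H) : H →ₗ.[ℂ] H :=
  (B : H →ₗ[ℂ] H).toPMap ⊤

/-- The densely defined operators `A` and `B` are quasi-similar with intertwining operator `T`:
`T` is bounded and invertible with densely defined inverse, `T D(A) ⊆ D(B)`, and `B T x = T A x`
for all `x ∈ D(A)`. -/
structure IsQuasiSimilarVia {K : Type*} [NormedAddCommGroup K] [InnerProductSpace ℂ K]
    (A : H →ₗ.[ℂ] H) (B : K →ₗ.[ℂ] K) (T : H →L[ℂ] K) : Prop where
  dense_left : Dense (A.domain : Set H)
  dense_right : Dense (B.domain : Set K)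
  injective : Function.Injective T
  denseRange : DenseRange T
  intertwines : ∀ x : A.domain, ∃ hx : T (x : H) ∈ B.domain, B ⟨T (x : H), hx⟩ = T (A x)

/-- `A ⊣ B`: quasi-similarity. -/
def IsQuasiSimilar {K : Type*} [NormedAddCommGroup K] [InnerProductSpace ℂ K]
    (A : H →ₗ.[ℂ] H) (B : K →ₗ.[ℂ] K) : Prop :=
  ∃ T : H →L[ℂ] K, IsQuasiSimilarVia A B T

end PipSpace

namespace PipSpace

open scoped InnerProductSpace Topology
open Filter

variable {H : Type*} [NormedAddCommGroup H] [InnerProductSpace ℂ H] [CompleteSpace H]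

/-! ### Self-adjoint operators through their graphs -/

/-! Put `C = (1 + G)^{-1/2}` and `D = G^{1/2} (1 + G)^{-1/2}`: commuting positive contractions with
`C² + D² = 1` and `G^{1/2} = D C⁻¹`, so unbounded operators can be handled through bounded ones. The
cone contains `(1 + G) + (1 + G⁻¹) = (C D)⁻²`, so admissibility makes `(C D)⁻¹` defined on `V^#`
with dense range (`exists_parametrization`). In the resulting coordinates `ℋ(G)`, `ℋ` and `ℋ(G⁻¹)`
become the ranges of `C²`, `C D` and `D²` in one copy of the Hilbert space (`isSqrtExt_iff`,
`embed_eq_pullback`).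

There `A` acts by `C² v ↦ C² B v` and `D² v ↦ D² B' v`. Symmetry of `A` gives `B' = B*`, and both
formulas agree on `ℋ(G) ∩ ℋ(G⁻¹)`. The operator `N = B D² + B* C²` is then symmetric for the form of
`(C D)²`, hence bounded for the weaker norm `‖C D ·‖` (`norm_apply_le_of_symmetric`). So `A`
restricts to a bounded, everywhere defined operator `M` on `ℋ` (`IsSqrtPair.exists_interpolation`).
Density, closedness and quasi-similarity to a bounded operator, namely `M` itself, follow. For
bounded `G` the operator `C` is onto, and comparing the two descriptions of `A` on `ℋ ⊆ ℋ(G)` gives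
the intertwining relation. -/

theorem mem_graph_iff_of_isSelfAdjoint {G : H →ₗ.[ℂ] H} (hG : IsSelfAdjoint G) (a b : H) :
    (a, b) ∈ G.graph ↔ ∀ x y : H, (x, y) ∈ G.graph → ⟪y, a⟫_ℂ = ⟪x, b⟫_ℂ := by
  have h := LinearPMap.adjoint_graph_eq_graph_adjoint hG.dense_domain
  rw [LinearPMap.isSelfAdjoint_def.1 hG] at h
  conv_lhs => rw [h, Submodule.mem_adjoint_iff]
  simp only [sub_eq_zero]

theorem isSelfAdjoint_of_mem_graph_iff {G : H →ₗ.[ℂ] H} (hd : Dense (G.domain : Set H))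
    (h : ∀ a b : H, (a, b) ∈ G.graph ↔ ∀ x y : H, (x, y) ∈ G.graph → ⟪y, a⟫_ℂ = ⟪x, b⟫_ℂ) :
    IsSelfAdjoint G := by
  rw [LinearPMap.isSelfAdjoint_def]
  apply LinearPMap.eq_of_eq_graph
  rw [LinearPMap.adjoint_graph_eq_graph_adjoint hd]
  ext ⟨a, b⟩
  rw [h, Submodule.mem_adjoint_iff]
  simp only [sub_eq_zero]

/-- Passing to adjoints reverses inclusions, so a self-adjoint operator has no proper self-adjoint
extension. -/
theorem eq_of_graph_le_of_isSelfAdjoint {S T : H →ₗ.[ℂ] H} (hS : IsSelfAdjoint S)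
    (hT : IsSelfAdjoint T) (h : S.graph ≤ T.graph) : T = S := by
  apply LinearPMap.eq_of_eq_graph
  refine le_antisymm ?_ h
  rintro ⟨a, b⟩ hab
  rw [mem_graph_iff_of_isSelfAdjoint hS]
  exact fun x y hxy => (mem_graph_iff_of_isSelfAdjoint hT a b).1 hab x y (h hxy)

theorem re_inner_nonneg_of_mem_graph {G : H →ₗ.[ℂ] H}
    (h : ∀ x : G.domain, 0 ≤ (⟪G x, (x : H)⟫_ℂ).re) {x y : H} (hxy : (x, y) ∈ G.graph) :
    0 ≤ (⟪y, x⟫_ℂ).re := by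
  obtain ⟨z, rfl, rfl⟩ := (LinearPMap.mem_graph_iff G).1 hxy
  exact h z

/-! ### Operators with a bounded parametrization of their graphs -/

/-- The operator `D C⁻¹`, with graph `{(C u, D u)}`, for bounded `C`, `D` with `C` injective. -/
noncomputable def pairOp (C D : H →L[ℂ] H) : H →ₗ.[ℂ] H :=
  (LinearMap.range ((C.prod D : H →L[ℂ] H × H) : H →ₗ[ℂ] H × H)).toLinearPMap

theorem mem_graph_pairOp {C : H →L[ℂ] H} (D : H →L[ℂ] H) (hC : Function.Injective C) {x y : H} :
    (x, y) ∈ (pairOp C D).graph ↔ ∃ u, C u = x ∧ D u = y := by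
  rw [pairOp, Submodule.toLinearPMap_graph_eq]
  · simp [Prod.ext_iff]
  · rintro ⟨a, b⟩ ⟨u, hu⟩ h
    simp only [ContinuousLinearMap.coe_coe, ContinuousLinearMap.prod_apply, Prod.mk.injEq] at hu h
    obtain ⟨rfl, rfl⟩ := hu
    have : u = 0 := hC (by rw [h, map_zero])
    simp [this]

theorem mem_domain_pairOp {C : H →L[ℂ] H} (D : H →L[ℂ] H) (hC : Function.Injective C) {x : H} :
    x ∈ (pairOp C D).domain ↔ ∃ u, C u = x := by
  rw [LinearPMap.mem_domain_iff]
  simp only [mem_graph_pairOp D hC]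
  exact ⟨fun ⟨_, u, hu, _⟩ => ⟨u, hu⟩, fun ⟨u, hu⟩ => ⟨_, u, hu, rfl⟩⟩

theorem pairOp_apply {C : H →L[ℂ] H} (D : H →L[ℂ] H) (hC : Function.Injective C)
    (x : (pairOp C D).domain) {u : H} (hu : C u = x) : pairOp C D x = D u := by
  have h1 := (pairOp C D).mem_graph x
  obtain ⟨v, hv, hv'⟩ := (mem_graph_pairOp D hC).1 h1
  rw [← hv', hC (hu.trans hv.symm)]

theorem _root_.ContinuousLinearMap.IsPositive.inner_swap {C : H →L[ℂ] H} (hC : C.IsPositive)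
    (x y : H) : ⟪C x, y⟫_ℂ = ⟪x, C y⟫_ℂ := hC.isSymmetric x y

theorem denseRange_of_isPositive {C : H →L[ℂ] H} (hC : C.IsPositive)
    (hi : Function.Injective C) : DenseRange C := by
  have h : (LinearMap.range (C : H →ₗ[ℂ] H)).topologicalClosure = ⊤ := by
    rw [Submodule.topologicalClosure_eq_top_iff, Submodule.eq_bot_iff]
    intro x hx
    apply hi
    rw [map_zero, ← inner_self_eq_zero (𝕜 := ℂ), ← hC.inner_swap]
    exact (Submodule.mem_orthogonal _ _).1 hx _ ⟨C x, rfl⟩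
  exact (Submodule.dense_iff_topologicalClosure_eq_top.2 h)

/-- The Bézout identity `U C + V D = 1` recovers the parameter: a pair in the adjoint graph
satisfies `D a = C b`, and then `u = U a + V b` gives `C u = a` and `D u = b`. -/
theorem isSelfAdjoint_pairOp {C D U V : H →L[ℂ] H} (hC : C.IsPositive) (hD : D.IsPositive)
    (hi : Function.Injective C) (hCD : ∀ x, C (D x) = D (C x)) (hUC : ∀ x, C (U x) = U (C x))
    (hVC : ∀ x, C (V x) = V (C x)) (hUD : ∀ x, D (U x) = U (D x)) (hVD : ∀ x, D (V x) = V (D x))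
    (h1 : ∀ x, U (C x) + V (D x) = x) : IsSelfAdjoint (pairOp C D) := by
  apply isSelfAdjoint_of_mem_graph_iff
  · refine (denseRange_of_isPositive hC hi).mono ?_
    rintro _ ⟨u, rfl⟩
    exact (mem_domain_pairOp D hi).2 ⟨u, rfl⟩
  · intro a b
    simp only [mem_graph_pairOp D hi]
    constructor
    · rintro ⟨u, rfl, rfl⟩ _ _ ⟨v, rfl, rfl⟩
      rw [hD.inner_swap, hC.inner_swap, hCD]
    · intro h
      have h2 : D a = C b := by
        refine ext_inner_left ℂ fun v => ?_
        rw [← hD.inner_swap, ← hC.inner_swap]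
        exact h _ _ ⟨v, rfl, rfl⟩
      refine ⟨U a + V b, ?_, ?_⟩
      · rw [map_add, hUC, hVC, ← h2, h1]
      · rw [map_add, hUD, hVD, h2, h1]

/-- Bounded positive commuting operators `C`, `D` with `C² + D² = 1` and `C` injective; they
represent the positive self-adjoint operator `D C⁻¹`. -/
structure IsSqrtPair (C D : H →L[ℂ] H) : Prop where
  pos_left : C.IsPositive
  pos_right : D.IsPositive
  injective : Function.Injective C
  comm : ∀ x, C (D x) = D (C x)
  sq_add_sq : ∀ x, C (C x) + D (D x) = x

theorem IsSqrtPair.isSelfAdjoint {C D : H →L[ℂ] H} (h : IsSqrtPair C D) :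
    IsSelfAdjoint (pairOp C D) :=
  isSelfAdjoint_pairOp (U := C) (V := D) h.pos_left h.pos_right h.injective h.comm (fun _ => rfl)
    h.comm (fun x => (h.comm x).symm) (fun _ => rfl) h.sq_add_sq

theorem isPositive_mul_of_comm {C D : H →L[ℂ] H} (hC : C.IsPositive) (hD : D.IsPositive)
    (hCD : ∀ x, C (D x) = D (C x)) : (C * D).IsPositive := by
  rw [← ContinuousLinearMap.nonneg_iff_isPositive] at *
  exact Commute.mul_nonneg hC hD (ContinuousLinearMap.ext hCD)

theorem pairOp_nonneg {C D : H →L[ℂ] H} (hC : C.IsPositive) (hD : D.IsPositive)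
    (hi : Function.Injective C) (hCD : ∀ x, C (D x) = D (C x)) (x : (pairOp C D).domain) :
    0 ≤ (⟪pairOp C D x, (x : H)⟫_ℂ).re := by
  obtain ⟨u, hu⟩ := (mem_domain_pairOp D hi).1 x.2
  rw [pairOp_apply D hi x hu, ← hu, ← hC.inner_swap]
  exact (isPositive_mul_of_comm hC hD hCD).re_inner_nonneg_left u

theorem isSelfAdjoint_pairOp_one {P : H →L[ℂ] H} (hP : P.IsPositive) (hi : Function.Injective P) :
    IsSelfAdjoint (pairOp P 1) :=
  isSelfAdjoint_pairOp (U := 0) (V := 1) hP ContinuousLinearMap.isPositive_one hi (fun _ => rfl)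
    (fun _ => by simp) (fun _ => rfl) (fun _ => rfl) (fun _ => rfl) (fun _ => by simp)

/-! ### The resolvent of a positive self-adjoint operator -/

theorem norm_le_norm_add {x y : H} (h : 0 ≤ (⟪y, x⟫_ℂ).re) : ‖x‖ ≤ ‖x + y‖ := by
  have h1 := norm_add_sq (𝕜 := ℂ) y x
  rw [add_comm y x] at h1
  have h2 : 0 ≤ RCLike.re ⟪y, x⟫_ℂ := h
  exact le_of_sq_le_sq (by nlinarith [sq_nonneg ‖y‖]) (norm_nonneg _)

/-- Positivity makes `1 + G` bounded below, so its range is closed. Self-adjointness puts any `v`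
orthogonal to the range into the domain with `G v = -v`, which positivity forbids unless `v = 0`. -/
theorem exists_mem_graph_add_eq {G : H →ₗ.[ℂ] H} (hG : IsSelfAdjoint G)
    (hp : ∀ x : G.domain, 0 ≤ (⟪G x, (x : H)⟫_ℂ).re) (w : H) :
    ∃ x y, (x, y) ∈ G.graph ∧ x + y = w := by
  let φ : G.graph →L[ℂ] H :=
    (ContinuousLinearMap.fst ℂ H H + ContinuousLinearMap.snd ℂ H H).comp G.graph.subtypeL
  have hφ : ∀ z : G.graph, φ z = z.1.1 + z.1.2 := fun _ => rfl
  have hb : ∀ z : G.graph, ‖z‖ ≤ (2 : NNReal) * ‖φ z‖ := by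
    rintro ⟨⟨x, y⟩, hz⟩
    have h1 := norm_le_norm_add (re_inner_nonneg_of_mem_graph hp hz)
    have h2 : ‖y‖ ≤ ‖x + y‖ + ‖x‖ := by simpa using norm_sub_le (x + y) x
    rw [hφ]
    simp only [Submodule.coe_norm, Prod.norm_def, NNReal.coe_ofNat]
    exact max_le (by linarith [norm_nonneg x]) (by linarith)
  have hcl : IsClosed (G.graph : Set (H × H)) := hG.isClosed
  have : CompleteSpace G.graph := hcl.completeSpace_coe
  have hr : IsClosed (Set.range φ) :=
    (AddMonoidHomClass.antilipschitz_of_bound φ hb).isClosed_range φ.uniformContinuous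
  have htop : (LinearMap.range (φ : G.graph →ₗ[ℂ] H)) = ⊤ := by
    have : CompleteSpace (LinearMap.range (φ : G.graph →ₗ[ℂ] H)) := by
      have : IsClosed (LinearMap.range (φ : G.graph →ₗ[ℂ] H) : Set H) := hr
      exact this.completeSpace_coe
    rw [← Submodule.orthogonal_eq_bot_iff, Submodule.eq_bot_iff]
    intro v hv
    have h1 : (v, -v) ∈ G.graph := by
      rw [mem_graph_iff_of_isSelfAdjoint hG]
      intro x y hxy
      have := (Submodule.mem_orthogonal _ _).1 hv _ ⟨⟨(x, y), hxy⟩, rfl⟩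
      have h3 : ⟪x + y, v⟫_ℂ = 0 := this
      rw [inner_add_left] at h3
      rw [inner_neg_right]
      linear_combination h3
    have h2 := norm_le_norm_add (re_inner_nonneg_of_mem_graph hp h1)
    simpa using h2
  obtain ⟨z, hz⟩ := LinearMap.range_eq_top.1 htop w
  exact ⟨z.1.1, z.1.2, z.2, hz⟩

/-- `R = (1 + G)⁻¹`. -/
theorem exists_resolvent {G : H →ₗ.[ℂ] H} (hG : IsSelfAdjoint G)
    (hp : ∀ x : G.domain, 0 ≤ (⟪G x, (x : H)⟫_ℂ).re) :
    ∃ R : H →L[ℂ] H, R.IsPositive ∧ (1 - R).IsPositive ∧ Function.Injective R ∧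
      ∀ x y, (x, y) ∈ G.graph ↔ R (x + y) = x := by
  choose r s hrs hadd using exists_mem_graph_add_eq hG hp
  have huniq : ∀ x y, (x, y) ∈ G.graph → r (x + y) = x := by
    intro x y hxy
    have h1 := G.graph.sub_mem (hrs (x + y)) hxy
    have h2 := norm_le_norm_add (re_inner_nonneg_of_mem_graph hp h1)
    have h3 : r (x + y) - x + (s (x + y) - y) = 0 := by
      rw [sub_add_sub_comm, hadd, sub_self]
    rw [h3, norm_zero] at h2
    exact sub_eq_zero.1 (norm_le_zero_iff.1 h2)
  have hnorm : ∀ w, ‖r w‖ ≤ 1 * ‖w‖ := fun w => by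
    have := norm_le_norm_add (re_inner_nonneg_of_mem_graph hp (hrs w))
    rwa [hadd, ← one_mul ‖w‖] at this
  let R : H →L[ℂ] H := LinearMap.mkContinuous
    { toFun := r
      map_add' := fun v w => by
        have := huniq _ _ (G.graph.add_mem (hrs v) (hrs w))
        rwa [add_add_add_comm, hadd, hadd] at this
      map_smul' := fun c v => by
        have := huniq _ _ (G.graph.smul_mem c (hrs v))
        rw [RingHom.id_apply]
        conv_rhs => rw [← this]
        rw [← smul_add, hadd] } 1 hnorm
  have hR : ∀ w, R w = r w := fun _ => rfl
  have hs : ∀ w, s w = w - r w := fun w => eq_sub_of_add_eq' (hadd w)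
  have hsymm : ∀ v w, ⟪r v, w⟫_ℂ = ⟪v, r w⟫_ℂ := by
    intro v w
    have h1 := (mem_graph_iff_of_isSelfAdjoint hG _ _).1 (hrs w) _ _ (hrs v)
    rw [hs, hs, inner_sub_left, inner_sub_right] at h1
    linear_combination -h1
  have hpos : ∀ w, 0 ≤ (⟪w - r w, r w⟫_ℂ).re := fun w => by
    have := re_inner_nonneg_of_mem_graph hp (hrs w)
    rwa [hs] at this
  have hself : ∀ v : H, 0 ≤ (⟪v, v⟫_ℂ).re := fun v => inner_self_nonneg (𝕜 := ℂ)
  refine ⟨R, ⟨fun v w => hsymm v w, fun w => ?_⟩, ⟨fun v w => ?_, fun w => ?_⟩, ?_, ?_⟩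
  · change 0 ≤ (⟪r w, w⟫_ℂ).re
    have h1 := hpos w
    have h2 := hself (r w)
    have h3 : ⟪r w, w⟫_ℂ = ⟪w - r w, r w⟫_ℂ + ⟪r w, r w⟫_ℂ := by
      rw [hsymm, inner_sub_left]; ring
    rw [h3, Complex.add_re]
    exact add_nonneg h1 h2
  · change ⟪v - r v, w⟫_ℂ = ⟪v, w - r w⟫_ℂ
    rw [inner_sub_left, inner_sub_right, hsymm]
  · change 0 ≤ (⟪w - r w, w⟫_ℂ).re
    have h3 : ⟪w - r w, w⟫_ℂ = ⟪w - r w, r w⟫_ℂ + ⟪w - r w, w - r w⟫_ℂ := by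
      rw [← inner_add_right, add_sub_cancel]
    rw [h3, Complex.add_re]
    exact add_nonneg (hpos w) (hself _)
  · rw [injective_iff_map_eq_zero]
    intro w hw
    have h1 := hrs w
    rw [hR] at hw
    rw [hw] at h1
    have h2 := LinearPMap.graph_fst_eq_zero_snd _ h1 rfl
    rw [← hadd w, hw, h2, add_zero]
  · intro x y
    refine ⟨huniq x y, fun h => ?_⟩
    have h1 := hrs (x + y)
    rw [hs, ← hR, h] at h1
    simpa using h1

/-! ### The positive square root -/

theorem exists_isSqrtPair {R : H →L[ℂ] H} (hR : R.IsPositive) (hR1 : (1 - R).IsPositive)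
    (hi : Function.Injective R) :
    ∃ C D : H →L[ℂ] H, IsSqrtPair C D ∧ ∀ x, C (C x) = R x := by
  rw [← ContinuousLinearMap.nonneg_iff_isPositive] at hR hR1
  have hC := CFC.sqrt_mul_sqrt_self R hR
  have hD := CFC.sqrt_mul_sqrt_self (1 - R) hR1
  have hc : Commute (CFC.sqrt R) (CFC.sqrt (1 - R)) := by
    have h : Commute R (1 - R) := (Commute.one_right R).sub_right (Commute.refl R)
    exact ((h.cfcₙ_nnreal _).symm.cfcₙ_nnreal _).symm
  have hC' : ∀ x, CFC.sqrt R (CFC.sqrt R x) = R x := fun x => DFunLike.congr_fun hC x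
  have hD' : ∀ x, CFC.sqrt (1 - R) (CFC.sqrt (1 - R) x) = x - R x :=
    fun x => DFunLike.congr_fun hD x
  refine ⟨CFC.sqrt R, CFC.sqrt (1 - R), ⟨?_, ?_, ?_, ?_, ?_⟩, hC'⟩
  · exact (ContinuousLinearMap.nonneg_iff_isPositive _).1 (CFC.sqrt_nonneg _)
  · exact (ContinuousLinearMap.nonneg_iff_isPositive _).1 (CFC.sqrt_nonneg _)
  · intro x y h
    exact hi (by rw [← hC', h, hC'])
  · exact fun x => DFunLike.congr_fun hc.eq x
  · intro x
    rw [hC', hD']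
    abel

/-- Formally `(D C⁻¹)² = (1 - R) R⁻¹ = G`, since `R = (1 + G)⁻¹ = C²`. -/
theorem isPositiveSqrt_pairOp {G : H →ₗ.[ℂ] H} {R C D : H →L[ℂ] H} (h : IsSqrtPair C D)
    (hR : ∀ x, C (C x) = R x) (hG : ∀ x y, (x, y) ∈ G.graph ↔ R (x + y) = x) :
    IsPositiveSqrt G (pairOp C D) := by
  refine ⟨h.isSelfAdjoint, pairOp_nonneg h.pos_left h.pos_right h.injective h.comm, ?_⟩
  intro x y
  simp only [hG, ← hR, mem_graph_pairOp D h.injective]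
  constructor
  · intro hxy
    refine ⟨D (C (x + y)), ⟨C (x + y), hxy, rfl⟩, D (x + y), h.comm _, ?_⟩
    have := h.sq_add_sq (x + y)
    rw [hxy] at this
    exact add_left_cancel this
  · rintro ⟨_, ⟨u, rfl, rfl⟩, v, hv, rfl⟩
    rw [map_add C (C u), h.comm v, hv, h.sq_add_sq]

/-- Uniqueness is reduced to bounded operators: `S R` is bounded and positive with square `(1 - R) R
= (C D)²`, so it equals `C D`. Thus `S` agrees with `D C⁻¹` on the range of `C²`; closedness of `S`
extends this to the range of `C`, and maximality of self-adjoint operators finishes. -/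
theorem eq_pairOp_of_isPositiveSqrt {G S : H →ₗ.[ℂ] H} {R C D : H →L[ℂ] H} (h : IsSqrtPair C D)
    (hR : ∀ x, C (C x) = R x) (hG : ∀ x y, (x, y) ∈ G.graph ↔ R (x + y) = x)
    (hS : IsPositiveSqrt G S) : S = pairOp C D := by
  have hgr : ∀ w, ∃ z, (R w, z) ∈ S.graph ∧ (z, w - R w) ∈ S.graph := fun w =>
    (hS.sq _ _).1 ((hG _ _).2 (by simp))
  choose q hq1 hq2 using hgr
  have hsym : ∀ {a b x y : H}, (a, b) ∈ S.graph → (x, y) ∈ S.graph → ⟪y, a⟫_ℂ = ⟪x, b⟫_ℂ :=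
    fun hab hxy => (mem_graph_iff_of_isSelfAdjoint hS.selfAdjoint _ _).1 hab _ _ hxy
  let Q : H →ₗ[ℂ] H :=
    { toFun := q
      map_add' := fun v w => by
        refine S.mem_graph_snd_inj (hq1 (v + w)) (S.graph.add_mem (hq1 v) (hq1 w)) ?_
        simp
      map_smul' := fun c v => by
        refine S.mem_graph_snd_inj (hq1 (c • v)) (S.graph.smul_mem c (hq1 v)) ?_
        simp }
  have hdec : ∀ v w, ⟪q v, w⟫_ℂ = ⟪q v, R w⟫_ℂ + ⟪q v, w - R w⟫_ℂ := fun v w => by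
    rw [← inner_add_right]; simp
  have hdec' : ∀ v w, ⟪v, q w⟫_ℂ = ⟪R v, q w⟫_ℂ + ⟪v - R v, q w⟫_ℂ := fun v w => by
    rw [← inner_add_left]; simp
  have hQs : Q.IsSymmetric := by
    intro v w
    change ⟪q v, w⟫_ℂ = ⟪v, q w⟫_ℂ
    rw [hdec, hdec', hsym (hq1 w) (hq1 v), hsym (hq2 w) (hq2 v)]
  -- Hellinger–Toeplitz: an everywhere defined symmetric operator is bounded.
  let T : H →L[ℂ] H := ⟨Q, hQs.continuous⟩
  have hT : T.IsPositive := by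
    refine ⟨hQs, fun w => ?_⟩
    change 0 ≤ (⟪q w, w⟫_ℂ).re
    rw [hdec, Complex.add_re, ← hsym (hq2 w) (hq2 w)]
    exact add_nonneg (re_inner_nonneg_of_mem_graph hS.nonneg (hq1 w))
      (re_inner_nonneg_of_mem_graph hS.nonneg (hq2 w))
  have hTT : T * T = (C * D) * (C * D) := by
    refine ContinuousLinearMap.ext fun w => ext_inner_left ℂ fun v => ?_
    change ⟪v, q (q w)⟫_ℂ = ⟪v, C (D (C (D w)))⟫_ℂ
    have h1 : ⟪v, q (q w)⟫_ℂ = ⟪q v, q w⟫_ℂ := (hQs v (q w)).symm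
    rw [h1, hsym (hq2 w) (hq1 v), ← hR v, h.pos_left.inner_swap, h.pos_left.inner_swap,
      ← h.comm (D w), sub_eq_of_eq_add' (a := w) (c := D (D w))]
    rw [← hR, h.sq_add_sq]
  have hTeq : T = C * D := by
    have hCD := isPositive_mul_of_comm h.pos_left h.pos_right h.comm
    rw [← ContinuousLinearMap.nonneg_iff_isPositive] at hT hCD
    rw [← CFC.sqrt_mul_self T hT, hTT, CFC.sqrt_mul_self _ hCD]
  refine eq_of_graph_le_of_isSelfAdjoint h.isSelfAdjoint hS.selfAdjoint ?_
  rintro ⟨x, y⟩ hxy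
  obtain ⟨u, rfl, rfl⟩ := (mem_graph_pairOp D h.injective).1 hxy
  have hcl : IsClosed {u : H | (C u, D u) ∈ S.graph} := by
    have h1 : IsClosed (S.graph : Set (H × H)) := hS.selfAdjoint.isClosed
    exact h1.preimage (C.continuous.prodMk D.continuous)
  refine (denseRange_of_isPositive h.pos_left h.injective).induction_on
    (p := fun u => (C u, D u) ∈ S.graph) u hcl fun a => ?_
  have h1 : q a = D (C a) := by rw [← h.comm]; exact DFunLike.congr_fun hTeq a
  have h2 := hq1 a
  rwa [h1, ← hR] at h2

/-- Uniqueness removes the arbitrary choice in `sqrtOp`. -/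
theorem sqrtOp_eq_of_isPositiveSqrt {G S : H →ₗ.[ℂ] H} (hG : IsSelfAdjoint G)
    (hp : ∀ x : G.domain, 0 ≤ (⟪G x, (x : H)⟫_ℂ).re) (hS : IsPositiveSqrt G S) :
    sqrtOp G = S := by
  obtain ⟨R, hR, hR1, hRi, hgr⟩ := exists_resolvent hG hp
  obtain ⟨C, D, hCD, hC⟩ := exists_isSqrtPair hR hR1 hRi
  have hex : ∃ S, IsPositiveSqrt G S := ⟨S, hS⟩
  rw [sqrtOp, dif_pos hex, eq_pairOp_of_isPositiveSqrt hCD hC hgr hex.choose_spec,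
    eq_pairOp_of_isPositiveSqrt hCD hC hgr hS]

theorem sqrtOp_pairOp_mul_self {P : H →L[ℂ] H} (hP : P.IsPositive) (hi : Function.Injective P) :
    sqrtOp (pairOp (P * P) 1) = pairOp P 1 := by
  have hPP : (P * P).IsPositive := isPositive_mul_of_comm hP hP fun _ => rfl
  have hii : Function.Injective (P * P : H →L[ℂ] H) := hi.comp hi
  have h1 := ContinuousLinearMap.isPositive_one (𝕜 := ℂ) (E := H)
  refine sqrtOp_eq_of_isPositiveSqrt (isSelfAdjoint_pairOp_one hPP hii)
    (pairOp_nonneg hPP h1 hii fun _ => rfl)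
    ⟨isSelfAdjoint_pairOp_one hP hi, pairOp_nonneg hP h1 hi fun _ => rfl, fun x y => ?_⟩
  simp [mem_graph_pairOp _ hi, mem_graph_pairOp _ hii]

theorem sqrtOp_idOp : sqrtOp (idOp H) = pairOp 1 1 := by
  have hi : Function.Injective (1 : H →L[ℂ] H) := Function.injective_id
  have h : idOp H = pairOp (1 * 1) 1 := by
    refine LinearPMap.eq_of_eq_graph ?_
    ext ⟨x, y⟩
    rw [mul_one, mem_graph_pairOp _ hi, LinearPMap.mem_graph_iff]
    simp [idOp]
  rw [h, sqrtOp_pairOp_mul_self ContinuousLinearMap.isPositive_one hi]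

namespace IsSqrtPair

theorem symm {C D : H →L[ℂ] H} (h : IsSqrtPair C D) (hD : Function.Injective D) :
    IsSqrtPair D C :=
  ⟨h.pos_right, h.pos_left, hD, fun x => (h.comm x).symm, fun x => by
    rw [add_comm, h.sq_add_sq]⟩

theorem inner_add_inner {C D : H →L[ℂ] H} (h : IsSqrtPair C D) (x y : H) :
    ⟪C x, C y⟫_ℂ + ⟪D x, D y⟫_ℂ = ⟪x, y⟫_ℂ := by
  rw [h.pos_left.inner_swap, h.pos_right.inner_swap, ← inner_add_right, h.sq_add_sq]

end IsSqrtPair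

/-- A metric operator `G` and its inverse in terms of bounded operators:
`C = (1 + G)^{-1/2}` and `D = G^{1/2} (1 + G)^{-1/2}`. -/
theorem IsMetricOperator.exists_isSqrtPair {G : H →ₗ.[ℂ] H} (hG : IsMetricOperator G) :
    ∃ C D : H →L[ℂ] H, IsSqrtPair C D ∧ Function.Injective D ∧ sqrtOp G = pairOp C D ∧
      sqrtOp G.inverse = pairOp D C ∧ ∀ u, (C (C u), D (D u)) ∈ G.graph := by
  obtain ⟨R, hR, hR1, hRi, hgr⟩ := exists_resolvent hG.selfAdjoint hG.nonneg
  obtain ⟨C, D, hCD, hC⟩ := PipSpace.exists_isSqrtPair hR hR1 hRi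
  -- With trivial kernel, the graph of `G.inverse` is the swapped graph of `G`.
  have hker : G.toFun.ker = ⊥ := by
    rw [LinearMap.ker_eq_bot']
    intro x hx
    refine Subtype.ext (hG.strict x ?_)
    have h0 : G x = 0 := hx
    rw [h0, inner_zero_left]
  have hD : Function.Injective D := by
    rw [injective_iff_map_eq_zero]
    intro x hx
    have hmem : (x, (0 : H)) ∈ G.graph := by
      rw [hgr, add_zero, ← hC]
      simpa [hx] using hCD.sq_add_sq x
    obtain ⟨z, rfl, hz⟩ := (LinearPMap.mem_graph_iff G).1 hmem
    exact hG.strict z (by rw [hz, inner_zero_left])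
  have hDC := hCD.symm hD
  have hinv : ∀ x y, (x, y) ∈ G.inverse.graph ↔ (y, x) ∈ G.graph := by
    intro x y
    rw [LinearPMap.inverse_graph hker, Submodule.mem_map]
    constructor
    · rintro ⟨⟨a, b⟩, hab, h⟩
      simp only [LinearEquiv.coe_coe, LinearEquiv.prodComm_apply, Prod.swap_prod_mk,
        Prod.mk.injEq] at h
      obtain ⟨rfl, rfl⟩ := h
      exact hab
    · exact fun h => ⟨(y, x), h, rfl⟩
  -- The resolvent of the inverse is complementary: `(1 + G⁻¹)⁻¹ = 1 - R = D²`. Inversion thus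
  -- exchanges `C` and `D`.
  have hinv' : ∀ x y, (x, y) ∈ G.inverse.graph ↔ (D * D) (x + y) = x := by
    intro x y
    rw [hinv, hgr, ← hC, add_comm y x]
    change _ ↔ D (D (x + y)) = x
    have h := hCD.sq_add_sq (x + y)
    constructor
    · intro h1
      rw [h1, add_comm x y] at h
      rw [add_comm x y]
      exact add_left_cancel h
    · intro h1
      rw [h1, add_comm x y] at h
      rw [add_comm x y]
      exact add_right_cancel h
  have hsa : IsSelfAdjoint G.inverse := by
    have hDD : Function.Injective (D * D : H →L[ℂ] H) := hD.comp hD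
    have h : G.inverse = pairOp (D * D) (C * C) := by
      refine LinearPMap.eq_of_eq_graph ?_
      ext ⟨x, y⟩
      rw [hinv', mem_graph_pairOp _ hDD]
      constructor
      · intro h
        refine ⟨x + y, h, ?_⟩
        have := hDC.sq_add_sq (x + y)
        change D (D (x + y)) = x at h
        rw [h] at this
        exact add_left_cancel this
      · rintro ⟨u, rfl, rfl⟩
        exact congrArg (D * D : H →L[ℂ] H) (hDC.sq_add_sq u)
    rw [h]
    refine isSelfAdjoint_pairOp (U := 1) (V := 1)
      (isPositive_mul_of_comm hDC.pos_left hDC.pos_left fun _ => rfl)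
      (isPositive_mul_of_comm hCD.pos_left hCD.pos_left fun _ => rfl) hDD (fun x => ?_)
      (fun _ => rfl) (fun _ => rfl) (fun _ => rfl) (fun _ => rfl) hDC.sq_add_sq
    simp [hCD.comm]
  have hnn : ∀ x : G.inverse.domain, 0 ≤ (⟪G.inverse x, (x : H)⟫_ℂ).re := by
    intro x
    have h := re_inner_nonneg_of_mem_graph hG.nonneg ((hinv _ _).1 (G.inverse.mem_graph x))
    rwa [← inner_conj_symm, Complex.conj_re] at h
  refine ⟨C, D, hCD, hD, ?_, ?_, fun u => ?_⟩
  · exact sqrtOp_eq_of_isPositiveSqrt hG.selfAdjoint hG.nonneg (isPositiveSqrt_pairOp hCD hC hgr)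
  · exact sqrtOp_eq_of_isPositiveSqrt hsa hnn
      (isPositiveSqrt_pairOp hDC (R := D * D) (fun _ => rfl) hinv')
  · rw [hgr, hCD.sq_add_sq, hC]

/-! ### Form sums -/

/-- Criterion for `P⁻²` to be a form sum: its form has domain `ran P` and value `⟪a, b⟫` at `(P a, P
b)`, so it suffices to match domains and values. -/
theorem isFormSum_pairOp {X Y : H →ₗ.[ℂ] H} {C D C' D' P : H →L[ℂ] H}
    (hX : sqrtOp X = pairOp C D) (hY : sqrtOp Y = pairOp C' D') (hC : Function.Injective C)
    (hC' : Function.Injective C') (hP : P.IsPositive) (hi : Function.Injective P)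
    (hdom : ∀ x, (∃ a, P a = x) ↔ (∃ u, C u = x) ∧ ∃ u, C' u = x)
    (hform : ∀ a b u v u' v', C u = P a → C v = P b → C' u' = P a → C' v' = P b →
      ⟪D u, D v⟫_ℂ + ⟪D' u', D' v'⟫_ℂ = ⟪a, b⟫_ℂ) :
    IsFormSum X Y (pairOp (P * P) 1) := by
  have hii : Function.Injective (P * P : H →L[ℂ] H) := hi.comp hi
  intro x z
  rw [hX, hY, mem_graph_pairOp _ hii]
  have hform' : ∀ a b (wX : P a ∈ (pairOp C D).domain) (wY : P a ∈ (pairOp C' D').domain)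
      (hX : P b ∈ (pairOp C D).domain) (hY : P b ∈ (pairOp C' D').domain),
      ⟪pairOp C D ⟨P a, wX⟩, pairOp C D ⟨P b, hX⟩⟫_ℂ
        + ⟪pairOp C' D' ⟨P a, wY⟩, pairOp C' D' ⟨P b, hY⟩⟫_ℂ = ⟪a, b⟫_ℂ := by
    intro a b wX wY hX hY
    obtain ⟨u, hu⟩ := (mem_domain_pairOp D hC).1 wX
    obtain ⟨v, hv⟩ := (mem_domain_pairOp D hC).1 hX
    obtain ⟨u', hu'⟩ := (mem_domain_pairOp D' hC').1 wY
    obtain ⟨v', hv'⟩ := (mem_domain_pairOp D' hC').1 hY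
    rw [pairOp_apply D hC _ hu, pairOp_apply D hC _ hv, pairOp_apply D' hC' _ hu',
      pairOp_apply D' hC' _ hv', hform a b u v u' v' hu hv hu' hv']
  have hdomX : ∀ a, P a ∈ (pairOp C D).domain := fun a =>
    (mem_domain_pairOp D hC).2 ((hdom _).1 ⟨a, rfl⟩).1
  have hdomY : ∀ a, P a ∈ (pairOp C' D').domain := fun a =>
    (mem_domain_pairOp D' hC').2 ((hdom _).1 ⟨a, rfl⟩).2
  constructor
  · rintro ⟨u, rfl, rfl⟩
    refine ⟨hdomX (P u), hdomY (P u), fun w wX wY => ?_⟩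
    obtain ⟨a, rfl⟩ := (hdom w).2 ⟨(mem_domain_pairOp D hC).1 wX, (mem_domain_pairOp D' hC').1 wY⟩
    exact (hP.inner_swap _ _).trans (hform' a (P u) wX wY _ _).symm
  · rintro ⟨hxX, hxY, h⟩
    obtain ⟨b, rfl⟩ := (hdom x).2 ⟨(mem_domain_pairOp D hC).1 hxX,
      (mem_domain_pairOp D' hC').1 hxY⟩
    refine ⟨z, congrArg (fun t => P t) ?_, rfl⟩
    refine ext_inner_left ℂ fun a => (hP.inner_swap a z).symm.trans ?_
    rw [h (P a) (hdomX a) (hdomY a), hform']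

/-- This is `X + 1 = C⁻²`: at `(C u, C v)` the summed form is `⟪D u, D v⟫ + ⟪C u, C v⟫ = ⟪u, v⟫`. -/
theorem isFormSum_idOp {X : H →ₗ.[ℂ] H} {C D : H →L[ℂ] H} (h : IsSqrtPair C D)
    (hX : sqrtOp X = pairOp C D) : IsFormSum X (idOp H) (pairOp (C * C) 1) := by
  refine isFormSum_pairOp hX sqrtOp_idOp h.injective Function.injective_id h.pos_left h.injective
    (fun x => by simp) ?_
  intro a b u v u' v' hu hv hu' hv'
  obtain rfl := h.injective hu
  obtain rfl := h.injective hv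
  obtain rfl : u' = C u := hu'
  obtain rfl : v' = C v := hv'
  rw [add_comm]
  exact h.inner_add_inner u v

/-- Formally `C⁻² + D⁻² = (C² + D²) (C D)⁻² = (C D)⁻²`. -/
theorem IsSqrtPair.isFormSum_inv_sq {C D : H →L[ℂ] H} (h : IsSqrtPair C D)
    (hD : Function.Injective D) :
    IsFormSum (pairOp (C * C) 1) (pairOp (D * D) 1) (pairOp ((C * D) * (C * D)) 1) := by
  refine isFormSum_pairOp (sqrtOp_pairOp_mul_self h.pos_left h.injective)
    (sqrtOp_pairOp_mul_self h.pos_right hD) h.injective hD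
    (isPositive_mul_of_comm h.pos_left h.pos_right h.comm) (h.injective.comp hD) ?_ ?_
  · intro x
    constructor
    · rintro ⟨a, rfl⟩
      exact ⟨⟨D a, rfl⟩, C a, (h.comm a).symm⟩
    · rintro ⟨⟨u, rfl⟩, v, hv⟩
      -- With `x = C u = D v`, formally `(C D)⁻¹ x = (C² + D²) (C D)⁻¹ x = C v + D u`.
      refine ⟨C v + D u, ?_⟩
      change C (D (C v + D u)) = C u
      rw [map_add, ← h.comm v, hv, h.sq_add_sq]
  · intro a b u v u' v' hu hv hu' hv'
    obtain rfl : u = D a := h.injective hu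
    obtain rfl : v = D b := h.injective hv
    obtain rfl : u' = C a := hD (hu'.trans (h.comm a))
    obtain rfl : v' = C b := hD (hv'.trans (h.comm b))
    rw [add_comm]
    exact h.inner_add_inner a b

/-! ### Parametrization of the conjugate dual of the smallest space -/

/-- The map `e` is `P⁻¹` restricted to `V^#`. Since `P⁻¹` carries the norm of `ℋ(P⁻²)` to that of
`H`, density of `V^#` in `ℋ(P⁻²)` becomes density of the range of `e`. -/
theorem exists_parametrization {O : Set (H →ₗ.[ℂ] H)} (hO : IsAdmissible O) {P : H →L[ℂ] H}
    (hP : P.IsPositive) (hi : Function.Injective P) (hcone : Cone O (pairOp (P * P) 1)) :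
    ∃ e : smallest O →ₗ[ℂ] H, (∀ y, P (e y) = y) ∧ DenseRange e := by
  have hle := hO.smallest_le _ hcone
  have hd := hO.dense _ hcone
  rw [sqrtOp_pairOp_mul_self hP hi] at hle hd
  have hval : ∀ y : (pairOp P 1).domain, P (pairOp P 1 y) = y := by
    intro y
    obtain ⟨u, hu⟩ := (mem_domain_pairOp 1 hi).1 y.2
    rw [pairOp_apply 1 hi y hu, ← hu]
    rfl
  refine ⟨(pairOp P 1).toFun ∘ₗ Submodule.inclusion hle, fun y => hval _, ?_⟩
  rw [DenseRange, Metric.dense_iff]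
  intro h ε hε
  obtain ⟨y, hy, hlt⟩ := hd ⟨P h, (mem_domain_pairOp 1 hi).2 ⟨h, rfl⟩⟩ ε hε
  rw [LinearPMap.map_sub, pairOp_apply 1 hi _ rfl, ← dist_eq_norm, dist_comm] at hlt
  exact ⟨_, hlt, ⟨y, hy⟩, rfl⟩

/-- The functional `y ↦ ⟪e y, h⟫` on the smallest space. -/
noncomputable def pullback {O : Set (H →ₗ.[ℂ] H)} (e : smallest O →ₗ[ℂ] H) :
    H →ₗ[ℂ] Ambient O where
  toFun h :=
    { toFun := fun y => ⟪e y, h⟫_ℂ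
      map_add' := fun y z => by rw [map_add, inner_add_left]
      map_smul' := fun c y => by rw [map_smul, inner_smul_left]; rfl }
  map_add' h h' := by ext y; exact inner_add_right _ _ _
  map_smul' c h := by ext y; exact inner_smul_right _ _ _

theorem pullback_apply {O : Set (H →ₗ.[ℂ] H)} (e : smallest O →ₗ[ℂ] H) (h : H) (y : smallest O) :
    pullback e h y = ⟪e y, h⟫_ℂ := rfl

theorem pullback_injective {O : Set (H →ₗ.[ℂ] H)} {e : smallest O →ₗ[ℂ] H} (he : DenseRange e) :
    Function.Injective (pullback e) := by
  intro h k hk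
  exact he.eq_of_inner_right ℂ fun y => DFunLike.congr_fun hk y

theorem embed_eq_pullback {O : Set (H →ₗ.[ℂ] H)} {e : smallest O →ₗ[ℂ] H} {P : H →L[ℂ] H}
    (hP : P.IsPositive) (he : ∀ y, P (e y) = y) (x : H) : embed O x = pullback e (P x) := by
  ext y
  change ⟪(y : H), x⟫_ℂ = ⟪e y, P x⟫_ℂ
  rw [← hP.inner_swap, he]

/-- If `y = C D (e y)`, then `⟪y, C w⟫ = ⟪C² (e y), D w⟫`, where `D w = G^{1/2} (C w)`. Letting `D w
→ k` yields the functional `⟪e y, C² k⟫`; density of the range of `D` makes every `k` occur. -/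
theorem isSqrtExt_iff {O : Set (H →ₗ.[ℂ] H)} {e : smallest O →ₗ[ℂ] H} {G : H →ₗ.[ℂ] H}
    {C D : H →L[ℂ] H} (h : IsSqrtPair C D) (hD : Function.Injective D)
    (hG : sqrtOp G = pairOp C D) (he : ∀ y, C (D (e y)) = y) (f : Ambient O) (k : H) :
    IsSqrtExt O G f k ↔ f = pullback e (C (C k)) := by
  have hin : ∀ (y : smallest O) (w : H), embed O (C w) y = ⟪C (C (e y)), D w⟫_ℂ := by
    intro y w
    change ⟪(y : H), C w⟫_ℂ = _
    rw [← he y, h.comm, h.pos_right.inner_swap, ← h.comm, ← h.pos_left.inner_swap]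
  have hpb : ∀ (y : smallest O), pullback e (C (C k)) y = ⟪C (C (e y)), k⟫_ℂ := fun y => by
    rw [pullback_apply, ← h.pos_left.inner_swap, ← h.pos_left.inner_swap]
  unfold IsSqrtExt
  rw [hG]
  constructor
  · rintro ⟨u, hu, hf⟩
    ext y
    refine tendsto_nhds_unique (hf y) ?_
    rw [hpb]
    have : ∀ n, embed O (u n) y = ⟪C (C (e y)), pairOp C D (u n)⟫_ℂ := by
      intro n
      obtain ⟨w, hw⟩ := (mem_domain_pairOp D h.injective).1 (u n).2
      rw [pairOp_apply D h.injective _ hw, ← hw, hin]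
    simp only [this]
    exact tendsto_const_nhds.inner hu
  · rintro rfl
    obtain ⟨s, hs, hsk⟩ := mem_closure_iff_seq_limit.1 (denseRange_of_isPositive h.pos_right hD k)
    choose w hw using hs
    have hval : ∀ n, pairOp C D ⟨C (w n), (mem_domain_pairOp D h.injective).2 ⟨w n, rfl⟩⟩ = s n :=
      fun n => (pairOp_apply D h.injective _ rfl).trans (hw n)
    refine ⟨fun n => ⟨C (w n), (mem_domain_pairOp D h.injective).2 ⟨w n, rfl⟩⟩, ?_, fun y => ?_⟩
    · simp only [hval]
      exact hsk
    · simp only [hin, hpb, hw]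
      exact tendsto_const_nhds.inner hsk

/-! ### Boundedness of symmetrizable operators -/

/-- Iterated doubling gives `a 1 ^ 2 ^ n * a 0 ≤ K * (c * a 0) ^ 2 ^ n`. If `c * a 0 < a 1`,
dividing by `a 1 ^ 2 ^ n` and letting `n` grow forces `a 0 ≤ 0`. -/
theorem le_of_forall_sq_le {a : ℕ → ℝ} {K c : ℝ} (h0 : ∀ k, 0 ≤ a k) (hc : 0 ≤ c)
    (hsq : ∀ k, a k ^ 2 ≤ a (2 * k) * a 0) (hK : ∀ k, a k ≤ K * c ^ k) : a 1 ≤ c * a 0 := by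
  have hpow : ∀ n : ℕ, a 1 ^ 2 ^ n * a 0 ≤ a (2 ^ n) * a 0 ^ 2 ^ n := by
    intro n
    induction n with
    | zero => simp
    | succ n ih =>
      rcases (h0 0).eq_or_lt with hz | hpos
      · rw [← hz, zero_pow (by positivity)]
        simp
      · have h1 : (a 1 ^ 2 ^ n * a 0) ^ 2 ≤ (a (2 ^ n) * a 0 ^ 2 ^ n) ^ 2 :=
          pow_le_pow_left₀ (mul_nonneg (pow_nonneg (h0 1) _) (h0 0)) ih 2
        have h2 : a (2 ^ n) ^ 2 ≤ a (2 ^ (n + 1)) * a 0 := by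
          rw [pow_succ' 2 n]
          exact hsq _
        have h3 : (a 1 ^ 2 ^ (n + 1) * a 0) * a 0
            ≤ (a (2 ^ (n + 1)) * a 0 ^ 2 ^ (n + 1)) * a 0 := by
          calc (a 1 ^ 2 ^ (n + 1) * a 0) * a 0 = (a 1 ^ 2 ^ n * a 0) ^ 2 := by
                rw [pow_succ 2 n, pow_mul]; ring
            _ ≤ (a (2 ^ n) * a 0 ^ 2 ^ n) ^ 2 := h1
            _ = a (2 ^ n) ^ 2 * a 0 ^ 2 ^ (n + 1) := by rw [pow_succ 2 n, pow_mul]; ring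
            _ ≤ (a (2 ^ (n + 1)) * a 0) * a 0 ^ 2 ^ (n + 1) :=
                mul_le_mul_of_nonneg_right h2 (pow_nonneg (h0 0) _)
            _ = _ := by ring
        exact le_of_mul_le_mul_right h3 hpos
  by_contra! hlt
  have ha1 : 0 < a 1 := (mul_nonneg hc (h0 0)).trans_lt hlt
  have ha0 : 0 < a 0 := by
    refine (h0 0).lt_of_ne' fun hz => ?_
    have := hsq 1
    rw [hz, mul_zero] at this
    exact absurd this (not_le.2 (pow_pos ha1 2))
  have hK0 : 0 ≤ K := by simpa using (h0 0).trans (hK 0)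
  set r := c * a 0 / a 1 with hr
  have hr0 : 0 ≤ r := div_nonneg (mul_nonneg hc (h0 0)) ha1.le
  have hr1 : r < 1 := (div_lt_one ha1).2 hlt
  have hbd : ∀ n : ℕ, a 0 ≤ K * r ^ 2 ^ n := by
    intro n
    have h1 : a 1 ^ 2 ^ n * a 0 ≤ K * (c * a 0) ^ 2 ^ n := by
      refine (hpow n).trans ?_
      rw [mul_pow, ← mul_assoc]
      exact mul_le_mul_of_nonneg_right (hK _) (pow_nonneg (h0 0) _)
    rw [hr, div_pow, ← mul_div_assoc, le_div_iff₀ (pow_pos ha1 _), mul_comm]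
    exact h1
  have hlim : Tendsto (fun n : ℕ => K * r ^ 2 ^ n) atTop (𝓝 (K * 0)) :=
    ((tendsto_pow_atTop_nhds_zero_of_lt_one hr0 hr1).comp
      (tendsto_pow_atTop_atTop_of_one_lt one_lt_two)).const_mul K
  rw [mul_zero] at hlim
  exact absurd (ge_of_tendsto' hlim hbd) (not_le.2 ha0)

/-- If `E² N` is symmetric, then `N` is bounded for the seminorm `‖E ·‖`. -/
theorem norm_apply_le_of_symmetric {E N : H →L[ℂ] H} (hE : E.IsPositive)
    (h : ∀ v w, ⟪E (E (N v)), w⟫_ℂ = ⟪v, E (E (N w))⟫_ℂ) (v : H) :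
    ‖E (N v)‖ ≤ ‖N‖ * ‖E v‖ := by
  have hpow : ∀ (k : ℕ) v w, ⟪E ((N ^ k) v), E w⟫_ℂ = ⟪E v, E ((N ^ k) w)⟫_ℂ := by
    intro k
    induction k with
    | zero => intro v w; simp
    | succ k ih =>
      intro v w
      have h1 : (N ^ (k + 1)) v = (N ^ k) (N v) := by rw [pow_succ]; rfl
      have h2 : (N ^ (k + 1)) w = N ((N ^ k) w) := by rw [pow_succ']; rfl
      rw [h1, ih, hE.inner_swap, h2, ← hE.inner_swap, ← hE.inner_swap, h, hE.inner_swap]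
  have hN : ∀ k : ℕ, ‖(N ^ k) v‖ ≤ ‖N‖ ^ k * ‖v‖ := by
    intro k
    induction k with
    | zero => simp
    | succ k ih =>
      have h2 : (N ^ (k + 1)) v = N ((N ^ k) v) := by rw [pow_succ']; rfl
      rw [h2, pow_succ', mul_assoc]
      exact (N.le_opNorm _).trans (mul_le_mul_of_nonneg_left ih (norm_nonneg _))
  -- Each `N ^ k` is symmetric for `⟪E ·, E ·⟫`, so Cauchy–Schwarz gives the doubling inequality.
  -- The crude bound `‖E‖ ‖N‖ ^ k ‖v‖` supplies the growth rate; the factor `‖E‖ ‖v‖` disappears in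
  -- the limit.
  have := le_of_forall_sq_le (a := fun k => ‖E ((N ^ k) v)‖) (K := ‖E‖ * ‖v‖) (c := ‖N‖)
    (fun _ => norm_nonneg _) (norm_nonneg _) (fun k => ?_) (fun k => ?_)
  · simpa using this
  · have h1 : (N ^ (2 * k)) v = (N ^ k) ((N ^ k) v) := by rw [two_mul, pow_add]; rfl
    calc ‖E ((N ^ k) v)‖ ^ 2 = ‖⟪E ((N ^ k) v), E ((N ^ k) v)⟫_ℂ‖ := by
          rw [inner_self_eq_norm_sq_to_K]; simp
      _ = ‖⟪E ((N ^ (2 * k)) v), E v⟫_ℂ‖ := by rw [← hpow, h1]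
      _ ≤ ‖E ((N ^ (2 * k)) v)‖ * ‖E v‖ := norm_inner_le_norm _ _
  · calc ‖E ((N ^ k) v)‖ ≤ ‖E‖ * (‖N‖ ^ k * ‖v‖) :=
          (E.le_opNorm _).trans (mul_le_mul_of_nonneg_left (hN k) (norm_nonneg _))
      _ = ‖E‖ * ‖v‖ * ‖N‖ ^ k := by ring

/-- Interpolation: operators `B` and `B'` that are bounded on `ℋ(G)` and `ℋ(G⁻¹)`, agree on the
intersection and are adjoint to each other, are restrictions of an operator that is bounded
on `ℋ`. -/
theorem IsSqrtPair.exists_interpolation {C D B B' : H →L[ℂ] H} (h : IsSqrtPair C D)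
    (hD : Function.Injective D) (hcomp : ∀ v, C (C (B (D (D v)))) = D (D (B' (C (C v)))))
    (hadj : ∀ v w, ⟪v, B' w⟫_ℂ = ⟪B v, w⟫_ℂ) :
    ∃ M : H →L[ℂ] H,
      ∀ x, C (C (B (C (D x)))) + D (D (B' (C (D x)))) = C (D (M x)) := by
  set E : H →L[ℂ] H := C * D with hEdef
  have hE : E.IsPositive := isPositive_mul_of_comm h.pos_left h.pos_right h.comm
  have hEapp : ∀ x, E x = C (D x) := fun _ => rfl
  have hEi : Function.Injective E := h.injective.comp hD
  have hEE : ∀ x, E (E x) = C (C (D (D x))) := fun x => by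
    rw [hEapp, hEapp, ← h.comm]
  have hEE' : ∀ x, E (E x) = D (D (C (C x))) := fun x => by
    rw [hEE, h.comm, h.comm, h.comm, h.comm]
  set N : H →L[ℂ] H := B * (D * D) + B' * (C * C) with hNdef
  have hN : ∀ v, N v = B (D (D v)) + B' (C (C v)) := fun _ => rfl
  have hNE : ∀ v, E (E (N v)) = C (C (B (D (D v)))) := by
    intro v
    rw [hN, map_add, map_add, hEE, hEE, ← hcomp, ← map_add, ← map_add, add_comm, h.sq_add_sq]
  -- `E² N = C² B D²` has adjoint `D² B' C²`, which is the same operator by `hcomp`.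
  have hbound := norm_apply_le_of_symmetric (N := N) hE fun v w => by
    rw [hNE, hNE, h.pos_left.inner_swap, h.pos_left.inner_swap, ← hadj, h.pos_right.inner_swap,
      h.pos_right.inner_swap, ← hcomp]
  have hdense := denseRange_of_isPositive hE hEi
  let M : H →L[ℂ] H := ((E * N : H →L[ℂ] H) : H →ₗ[ℂ] H).extendOfNorm (E : H →ₗ[ℂ] H)
  have hM : ∀ v, M (E v) = E (N v) := fun v =>
    LinearMap.extendOfNorm_eq (f := ((E * N : H →L[ℂ] H) : H →ₗ[ℂ] H)) (e := (E : H →ₗ[ℂ] H))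
      hdense ⟨‖N‖, hbound⟩ v
  refine ⟨M, fun x => ?_⟩
  refine hdense.induction_on
    (p := fun x => C (C (B (C (D x)))) + D (D (B' (C (D x)))) = C (D (M x))) x
    (isClosed_eq (by fun_prop) (by fun_prop)) fun v => ?_
  -- For `x = E v` both terms take the form `C² B D²`, applied to `C² v` and `D² v`; they add up to
  -- `C² B D² v = E² N v`.
  have h1 : C (C (B (E (E v)))) = C (C (B (D (D (C (C v)))))) := by rw [hEE']
  have h2 : D (D (B' (E (E v)))) = C (C (B (D (D (D (D v)))))) := by rw [hEE, hcomp]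
  rw [hM, ← hEapp (E (N v)), ← hEapp (E v), h1, h2, hNE]
  simp only [← map_add, h.sq_add_sq]

/-! ### Operators on the pip-space -/

theorem exists_bounded_representative {O : Set (H →ₗ.[ℂ] H)} {e : smallest O →ₗ[ℂ] H}
    (he : DenseRange e) {A : Ambient O →ₗ.[ℂ] Ambient O} {P : H →L[ℂ] H}
    (hP : Function.Injective P) {c : ℝ}
    (h : ∀ v, ∃ w, (pullback e (P v), pullback e (P w)) ∈ A.graph ∧ ‖w‖ ≤ c * ‖v‖) :
    ∃ B : H →L[ℂ] H, ∀ v, (pullback e (P v), pullback e (P (B v))) ∈ A.graph := by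
  choose b hb hnorm using h
  have huniq : ∀ v w, (pullback e (P v), pullback e (P w)) ∈ A.graph → b v = w := fun v w hw =>
    hP (pullback_injective he (A.mem_graph_snd_inj (hb v) hw rfl))
  refine ⟨LinearMap.mkContinuous
    { toFun := b
      map_add' := fun v w => huniq _ _ ?_
      map_smul' := fun a v => huniq _ _ ?_ } c hnorm, hb⟩
  · simp only [map_add]
    exact A.graph.add_mem (hb v) (hb w)
  · simp only [map_smul]
    exact A.graph.smul_mem a (hb v)

theorem exists_bounded_of_mapsContinuously {O : Set (H →ₗ.[ℂ] H)} {e : smallest O →ₗ[ℂ] H}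
    (he : DenseRange e) {A : Ambient O →ₗ.[ℂ] Ambient O} {G : H →ₗ.[ℂ] H} {C : H →L[ℂ] H}
    (hC : Function.Injective C)
    (hext : ∀ f k, IsSqrtExt O G f k ↔ f = pullback e (C (C k)))
    (hA : MapsContinuously O A G G) :
    ∃ B : H →L[ℂ] H, ∀ v, (pullback e (C (C v)), pullback e (C (C (B v)))) ∈ A.graph := by
  obtain ⟨hdom, c, hc⟩ := hA
  refine exists_bounded_representative (P := C * C) he (hC.comp hC) (c := c) fun v => ?_
  have hmem : pullback e (C (C v)) ∈ A.domain := hdom ⟨v, (hext _ _).2 rfl⟩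
  obtain ⟨k, hk, hle⟩ := hc ⟨_, hmem⟩ v ((hext _ _).2 rfl)
  refine ⟨k, (LinearPMap.mem_graph_iff A).2 ⟨⟨_, hmem⟩, rfl, (hext _ _).1 hk⟩, hle⟩

theorem restrictToH_eq_ofBounded {O : Set (H →ₗ.[ℂ] H)} {A : Ambient O →ₗ.[ℂ] Ambient O}
    {M : H →L[ℂ] H} (hi : Function.Injective (embed O))
    (hM : ∀ x, (embed O x, embed O (M x)) ∈ A.graph) : restrictToH O A = ofBounded M := by
  have hiff : ∀ x y, (x, y) ∈ A.graph.comap ((embed O).prodMap (embed O)) ↔ y = M x := by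
    intro x y
    rw [Submodule.mem_comap]
    constructor
    · exact fun h => hi (A.mem_graph_snd_inj h (hM x) rfl)
    · rintro rfl
      exact hM x
  refine LinearPMap.eq_of_eq_graph ?_
  rw [restrictToH, Submodule.toLinearPMap_graph_eq]
  · ext ⟨x, y⟩
    rw [hiff, LinearPMap.mem_graph_iff]
    simp [ofBounded, eq_comm]
  · rintro ⟨x, y⟩ hxy rfl
    rw [(hiff _ _).1 hxy]
    exact map_zero M

theorem mem_graph_ofBounded (M : H →L[ℂ] H) (x y : H) :
    (x, y) ∈ (ofBounded M).graph ↔ M x = y := by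
  rw [LinearPMap.mem_graph_iff]
  simp [ofBounded]

theorem ofBounded_isClosed (M : H →L[ℂ] H) : (ofBounded M).IsClosed := by
  have h : ((ofBounded M).graph : Set (H × H)) = {p | M p.1 = p.2} := by
    ext ⟨x, y⟩
    exact mem_graph_ofBounded M x y
  rw [LinearPMap.IsClosed, h]
  exact isClosed_eq (by fun_prop) (by fun_prop)

theorem dense_ofBounded_domain (M : H →L[ℂ] H) : Dense ((ofBounded M).domain : Set H) :=
  dense_univ

theorem isQuasiSimilarVia_ofBounded {M B T : H →L[ℂ] H} (hi : Function.Injective T)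
    (hr : DenseRange T) (h : ∀ x, B (T x) = T (M x)) :
    IsQuasiSimilarVia (ofBounded M) (ofBounded B) T :=
  ⟨dense_ofBounded_domain M, dense_ofBounded_domain B, hi, hr,
    fun x => ⟨Submodule.mem_top, h x⟩⟩

/-- The square root of a bounded metric operator is bounded. -/
theorem IsSqrtPair.exists_bounded_sqrt {C D : H →L[ℂ] H} (h : IsSqrtPair C D) {K : ℝ}
    (hK : ∀ u, ‖D (D u)‖ ≤ K * ‖C (C u)‖) :
    Function.Surjective C ∧ ∃ T : H →L[ℂ] H, (∀ u, T (C u) = D u) ∧ ofBounded T = pairOp C D := by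
  -- Boundedness of `G = D² C⁻²` and `u = C² u + D² u` make `C` bounded below. Its range is then
  -- closed as well as dense.
  have hbound : ∀ u, ‖u‖ ≤ (((1 + |K|) * ‖C‖).toNNReal : ℝ) * ‖C u‖ := by
    intro u
    rw [Real.coe_toNNReal _ (by positivity)]
    calc ‖u‖ = ‖C (C u) + D (D u)‖ := by rw [h.sq_add_sq]
      _ ≤ ‖C (C u)‖ + K * ‖C (C u)‖ := (norm_add_le _ _).trans (by gcongr; exact hK u)
      _ ≤ ‖C (C u)‖ + |K| * ‖C (C u)‖ := by gcongr; exact le_abs_self K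
      _ = (1 + |K|) * ‖C (C u)‖ := by ring
      _ ≤ (1 + |K|) * (‖C‖ * ‖C u‖) := by gcongr; exact C.le_opNorm _
      _ = _ := by ring
  have hcl : IsClosed (Set.range C) :=
    (AddMonoidHomClass.antilipschitz_of_bound C hbound).isClosed_range C.uniformContinuous
  have hsurj : Function.Surjective C := by
    rw [← Set.range_eq_univ, ← hcl.closure_eq]
    exact (denseRange_of_isPositive h.pos_left h.injective).closure_range
  let Φ : H ≃L[ℂ] H := ContinuousLinearEquiv.ofBijective C
    (LinearMap.ker_eq_bot.2 h.injective) (LinearMap.range_eq_top.2 hsurj)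
  let T : H →L[ℂ] H := D.comp (Φ.symm : H →L[ℂ] H)
  have hT : ∀ u, T (C u) = D u := fun u => congrArg D (Φ.symm_apply_apply u)
  refine ⟨hsurj, T, hT, LinearPMap.eq_of_eq_graph ?_⟩
  ext ⟨x, y⟩
  rw [mem_graph_ofBounded, mem_graph_pairOp D h.injective]
  obtain ⟨u, rfl⟩ := hsurj x
  rw [hT]
  exact ⟨fun hu => ⟨u, rfl, hu⟩, fun ⟨v, hv, hy⟩ => h.injective hv ▸ hy⟩

/-- Three form sums: `1 + G = C⁻²`, `1 + G⁻¹ = D⁻²`, and the sum of these two. -/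
theorem IsSqrtPair.cone_inv_sq {O : Set (H →ₗ.[ℂ] H)} {G : H →ₗ.[ℂ] H} {C D : H →L[ℂ] H}
    (h : IsSqrtPair C D) (hD : Function.Injective D) (hI : idOp H ∈ O)
    (hG : sqrtOp G = pairOp C D) (hG' : sqrtOp G.inverse = pairOp D C) (hcone : Cone O G) :
    Cone O (pairOp ((C * D) * (C * D)) 1) :=
  .formSum (.formSum hcone (.of hI) (isFormSum_idOp h hG))
    (.formSum hcone.inv (.of hI) (isFormSum_idOp (h.symm hD) hG')) (h.isFormSum_inv_sq hD)

end PipSpace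

theorem mainTheorem11 {H : Type*} [NormedAddCommGroup H] [InnerProductSpace ℂ H] [CompleteSpace H]
    (O : Set (H →ₗ.[ℂ] H)) (hO : PipSpace.IsAdmissible O)
    (A : PipSpace.Ambient O →ₗ.[ℂ] PipSpace.Ambient O) (hA : PipSpace.IsSymmetricOperator O A)
    (G : H →ₗ.[ℂ] H) (hG : PipSpace.IsMetricOperator G) (hGA : (G, G) ∈ PipSpace.repSet O A) :
    Dense ((PipSpace.restrictToH O A).domain : Set H) ∧
    (∃ B' : H →L[ℂ] H,
      PipSpace.IsQuasiSimilar (PipSpace.restrictToH O A) (PipSpace.ofBounded B')) ∧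
    ∃ B : H →L[ℂ] H, PipSpace.IsConjugate O A G B ∧
      (PipSpace.IsBoundedMetricOperator G →
        (PipSpace.restrictToH O A).IsClosed ∧
        ∃ T : H →L[ℂ] H, PipSpace.ofBounded T = PipSpace.sqrtOp G ∧
          PipSpace.IsQuasiSimilarVia (PipSpace.restrictToH O A) (PipSpace.ofBounded B) T) := by
  open PipSpace in
  obtain ⟨C, D, h, hD, hsG, hsG', hgr⟩ := hG.exists_isSqrtPair
  obtain ⟨e, hE, he⟩ := exists_parametrization hO
    (isPositive_mul_of_comm h.pos_left h.pos_right h.comm) (h.injective.comp hD)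
    (h.cone_inv_sq hD hO.id_mem hsG hsG' hGA.1)
  have hext := isSqrtExt_iff h hD hsG hE
  have hext' := isSqrtExt_iff (h.symm hD) h.injective hsG' fun y => (h.comm _).symm.trans (hE y)
  have hemb : ∀ x, embed O x = pullback e (C (D x)) := fun x => embed_eq_pullback
    (isPositive_mul_of_comm h.pos_left h.pos_right h.comm) hE x
  have hpi := pullback_injective he
  have hembi : Function.Injective (embed O) := fun x y hxy => by
    rw [hemb, hemb] at hxy
    exact hD (h.injective (hpi hxy))
  obtain ⟨hGA', hpair⟩ := hA.2 G G hGA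
  obtain ⟨B, hB⟩ := exists_bounded_of_mapsContinuously he h.injective hext hGA.2.2
  obtain ⟨B', hB'⟩ := exists_bounded_of_mapsContinuously he hD hext' hGA'.2.2
  have hB₁ : ∀ v, ∃ f : A.domain, f = pullback e (C (C v)) ∧ A f = pullback e (C (C (B v))) :=
    fun v => (LinearPMap.mem_graph_iff A).1 (hB v)
  have hB₁' : ∀ v, ∃ f : A.domain, f = pullback e (D (D v)) ∧ A f = pullback e (D (D (B' v))) :=
    fun v => (LinearPMap.mem_graph_iff A).1 (hB' v)
  have hadj : ∀ v w, inner ℂ v (B' w) = inner ℂ (B v) w := by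
    intro v w
    obtain ⟨f, hf, hAf⟩ := hB₁ v
    obtain ⟨g, hg, hAg⟩ := hB₁' w
    exact hpair g f w v (B' w) (B v) ((hext' _ _).2 hg) ((hext _ _).2 hf) ((hext' _ _).2 hAg)
      ((hext _ _).2 hAf)
  have hcomp : ∀ v, C (C (B (D (D v)))) = D (D (B' (C (C v)))) := fun v =>
    hpi (A.mem_graph_snd_inj (hB (D (D v))) (hB' (C (C v)))
      (by rw [h.comm, h.comm, h.comm, h.comm]))
  obtain ⟨M, hM⟩ := h.exists_interpolation hD hcomp hadj
  have hgraph : ∀ x, (embed O x, embed O (M x)) ∈ A.graph := by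
    intro x
    -- The coordinate `C D x` of `x ∈ ℋ` splits as `C² (C D x) + D² (C D x)`, exhibiting `x` in
    -- `ℋ(G) + ℋ(G⁻¹)`.
    have h1 := A.graph.add_mem (hB (C (D x))) (hB' (C (D x)))
    rw [Prod.mk_add_mk, ← map_add, ← map_add, h.sq_add_sq, hM] at h1
    rwa [hemb, hemb]
  have hres := restrictToH_eq_ofBounded hembi hgraph
  rw [hres]
  refine ⟨dense_ofBounded_domain M, ⟨M, .id ℂ H, isQuasiSimilarVia_ofBounded
    Function.injective_id Function.surjective_id.denseRange fun _ => rfl⟩, B, fun v => ?_, ?_⟩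
  · obtain ⟨f, hf, hAf⟩ := hB₁ v
    exact ⟨f, (hext _ _).2 hf, (hext _ _).2 hAf⟩
  · rintro ⟨-, K, hK⟩
    obtain ⟨hsurj, T, hT, hTeq⟩ := h.exists_bounded_sqrt (K := K) fun u => by
      obtain ⟨z, hz, hGz⟩ := (LinearPMap.mem_graph_iff G).1 (hgr u)
      simpa only [hz, hGz] using hK z
    refine ⟨ofBounded_isClosed M, T, hTeq.trans hsG.symm, isQuasiSimilarVia_ofBounded ?_ ?_ ?_⟩
    · intro x y hxy
      obtain ⟨u, rfl⟩ := hsurj x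
      obtain ⟨v, rfl⟩ := hsurj y
      rw [hT, hT] at hxy
      rw [hD hxy]
    · refine (denseRange_of_isPositive h.pos_right hD).mono ?_
      rintro _ ⟨u, rfl⟩
      exact ⟨C u, hT u⟩
    · intro x
      obtain ⟨u, rfl⟩ := hsurj x
      -- For `x = C u` and `M x = C m`, the action of `A` on `ℋ` sends `C² D u` to `C² D m`, while
      -- on `ℋ(G)` it sends `C² D u` to `C² B D u`. Hence `B D u = D m`, which is `B T x = T M x`.
      obtain ⟨m, hm⟩ := hsurj (M (C u))
      have h1 := hgraph (C u)
      rw [hemb, hemb, ← hm, ← h.comm u, ← h.comm m] at h1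
      rw [hT, ← hm, hT]
      exact h.injective (h.injective (hpi (A.mem_graph_snd_inj (hB (D u)) h1 rfl)))
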